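/- Let $A,B\subset\mathbb R^3$ be convex polytopes (convex hulls of finitely many points) whose Minkowski sum $V=(-A)\oplus B=\{b-a : a\in A,\ b\in B\}$ has non-empty interior, and let $\Sigma$ be a positive definite $3\times 3$ covariance matrix. For a Gaussian position error $\epsilon\sim\mathcal N(0,\Sigma)$ let $p^*=P\big((A+\epsilon)\cap B\neq\varnothing\big)$ be the exact collision probability. Put $A'=\Sigma^{-1/2}A$, $B'=\Sigma^{-1/2}B$ and $V'=\Sigma^{-1/2}V$. Let $d$ be the minimum displacement vector between $A'$ and $B'$, i.e. the shortest vector of the form $b-a$ with $a\in A'$, $b\in B'$, and let $n_d$ be a unit vector with $d=\|d\|\,n_d$ (so $n_d=d/\|d\|$ if $A'$ and $B'$ are disjoint; if they meet, then $d=0$ and $n_d$ may be any unit vector). Define $$F(x)=\frac1{2\pi}\Big(1+\operatorname{erf}\Big(\frac{x\cdot n_d}{\sqrt2}\Big)\Big)\,n_d,\qquad \operatorname{erf}(x)=\frac{2}{\sqrt\pi}\int_0^x e^{-t^2}\,dt .$$ Let the boundary of $V'$ be triangulated by finitely many non-degenerate, non-overlapping triangles $\triangle S_{i1}S_{i2}S_{i3}$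 with outward unit normals $n_i$. Let $\epsilon_1,\epsilon_2,\dots$ be independent samples from $\mathcal N(0,\Sigma)$, and let $\hat p_n=\frac1n\sum_{k=1}^n I(\epsilon_k\in V)$ be the Monte Carlo estimate of the collision probability from $n$ samples. Then: 1. $p^*=P(\epsilon\in V)=\int_{V'}\frac1{\sqrt{8\pi^3}}\exp\big(-\tfrac12\|x\|^2\big)\,dx$. 2. For every $n\ge1$, $\hat p_n$ has mean $p^*$ and variance $p^*(1-p^*)/n$; the variance tends to $0$ as $n\to\infty$, and $\hat p_n\to p^*$ almost surely. 3. The exact probability satisfies $$p^*\le\sum_i\Big(\max_{j=1,2,3}F(S_{ij})\cdot n_i\Big)\operatorname{Area}(\triangle S_{i1}S_{i2}S_{i3}),$$ and hence, almost surely, $\limsup_{n\to\infty}\hat p_n$ is at most the same sum. -/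

import Mathlib

open MeasureTheory ProbabilityTheory Filter Topology
open scoped Pointwise RealInnerProductSpace MatrixOrder Matrix

noncomputable section

namespace PCD

/-- Three-dimensional Euclidean space. -/
abbrev E3 : Type := EuclideanSpace ℝ (Fin 3)

/-- A convex polytope: the convex hull of finitely many points. -/
def IsConvexPolytope (A : Set E3) : Prop :=
  ∃ s : Finset E3, A = convexHull ℝ (s : Set E3)

/-- The linear map `x ↦ S^{-1/2} x`, for a positive definite matrix `S`. -/
def whiten (S : Matrix (Fin 3) (Fin 3) ℝ) : E3 →L[ℝ] E3 :=
  Matrix.toEuclideanCLM (𝕜 := ℝ) (CFC.sqrt S)⁻¹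

/-- The collision probability: the probability that `A + ε` meets `B`, for `ε ~ N(0, S)`. -/
def collisionProb (S : Matrix (Fin 3) (Fin 3) ℝ) (A B : Set E3) : ℝ :=
  (multivariateGaussian (0 : E3) S).real {e | (((fun a => a + e) '' A) ∩ B).Nonempty}

/-- The transformed Minkowski sum `V' = S^{-1/2} ((-A) ⊕ B)`. -/
def whitenedSum (S : Matrix (Fin 3) (Fin 3) ℝ) (A B : Set E3) : Set E3 :=
  whiten S '' (-A + B)

/-- The Monte Carlo estimate from the first `n` samples: the fraction of the samples
`ε 0, …, ε (n - 1)` that lie in `(-A) ⊕ B`. -/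
def mcEstimate {Ω : Type*} (A B : Set E3) (ε : ℕ → Ω → E3) (n : ℕ) (ω : Ω) : ℝ :=
  (1 / (n : ℝ)) * ∑ i ∈ Finset.range n, (-A + B).indicator (fun _ => (1 : ℝ)) (ε i ω)

/-- The Gaussian error function. -/
def erf (x : ℝ) : ℝ := 2 / √Real.pi * ∫ t in (0 : ℝ)..x, Real.exp (-t ^ 2)

/-- The vector field `F(x) = (1 / 2π) (1 + erf (x · n / √2)) n`. -/
def fluxField (n x : E3) : E3 :=
  ((1 / (2 * Real.pi)) * (1 + erf (⟪x, n⟫ / √2))) • n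

/-- `d` is a minimum displacement vector from `P` to `Q`: a shortest vector among all
`q - p` with `p ∈ P` and `q ∈ Q`. -/
def IsMinDisplacement (P Q : Set E3) (d : E3) : Prop :=
  (∃ p ∈ P, ∃ q ∈ Q, d = q - p) ∧ ∀ p ∈ P, ∀ q ∈ Q, ‖d‖ ≤ ‖q - p‖

/-- `n` is a unit direction of the minimum displacement vector `d` from `P` to `Q`. If `P` and `Q`
are disjoint this means `n = d / ‖d‖`; if they meet then `d = 0`, and every unit vector counts. -/
def IsMinDisplacementDirection (P Q : Set E3) (n : E3) : Prop :=
  ‖n‖ = 1 ∧ ∃ d, IsMinDisplacement P Q d ∧ d = ‖d‖ • n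

/-- The area of a triangle: half the length of the cross product of two edge vectors. -/
def triangleArea (t : Affine.Triangle ℝ E3) : ℝ :=
  (1 / 2) * ‖WithLp.toLp 2
    (crossProduct (t.points 1 - t.points 0).ofLp (t.points 2 - t.points 0).ofLp)‖

/-- The triangles `T i` triangulate the boundary of `V`: their union is the boundary,
and no two of them overlap. -/
structure IsBoundaryTriangulation {ι : Type*} (V : Set E3) (T : ι → Affine.Triangle ℝ E3) :
    Prop where
  cover : ⋃ i, (T i).closedInterior = frontier V
  nonoverlap : Pairwise fun i j => Disjoint (T i).interior (T j).interior

/-- `n` is the outward unit normal of the boundary triangle `t` of the convex body `V`: a unit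
vector orthogonal to `t` such that `V` lies on the side of the plane of `t` opposite to `n`. -/
structure IsOutwardUnitNormal (V : Set E3) (t : Affine.Triangle ℝ E3) (n : E3) : Prop where
  unit : ‖n‖ = 1
  orthogonal : ∀ j k, ⟪t.points j - t.points k, n⟫ = 0
  outward : ∀ x ∈ V, ⟪x - t.points 0, n⟫ ≤ 0

/-- The surface bound `∑ i, (max_j F(S_ij) · n_i) * Area(triangle i)`. -/
def surfaceBound {ι : Type*} [Fintype ι] (T : ι → Affine.Triangle ℝ E3) (ν : ι → E3) (nd : E3) :
    ℝ :=
  ∑ i, (Finset.univ.sup' Finset.univ_nonempty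
    fun j : Fin 3 => ⟪fluxField nd ((T i).points j), ν i⟫) * triangleArea (T i)

end PCD

end

namespace PCD

/-! `A + ε` meets `B` exactly when `ε ∈ -A + B`, and whitening turns the probability of this event
into the standard Gaussian mass of a compact convex body V'. The Monte Carlo claims concern averages
of pairwise independent Bernoulli variables.

For the surface bound, write F(x) = g(⟪n, x⟫) n with n a unit vector and g nonnegative and
increasing. Discarding the components of x orthogonal to n, and a constant factor, bounds the
density by div F = g'(⟪n, x⟫) (`gaussianDensity_le_deriv`), so the mass is at most the flux of F
through the boundary. Only one direction of the divergence theorem is needed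
(`integral_deriv_le_sum_area`): by Fubini along n, each nonempty fiber of V' is a segment on which
g' integrates to a difference of end values; `fiber_increment_le` charges this difference to the
triangles over the base point; and projection along n scales the area of a triangle with normal ν by
|⟪n, ν⟫|. On each triangle F · ν is largest at a vertex (`fluxProfile_mul_le_sup'`). -/

/-! ### The standard Gaussian density on three-space -/

/-- The standard Gaussian product measure has the product of the densities as density. -/
lemma pi_gaussianReal_eq_withDensity {ι : Type*} [Fintype ι] :
    Measure.pi (fun _ : ι => gaussianReal 0 1) =
      volume.withDensity fun x => ENNReal.ofReal (∏ i, gaussianPDFReal 0 1 (x i)) := by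
  refine Measure.pi_eq fun s hs => ?_
  rw [withDensity_apply _ (MeasurableSet.univ_pi hs), volume_pi, Measure.restrict_pi_pi,
    ← ofReal_integral_eq_lintegral_ofReal, integral_fintype_prod_eq_prod,
    ENNReal.ofReal_prod_of_nonneg]
  · refine Finset.prod_congr rfl fun i _ => ?_
    rw [gaussianReal_apply_eq_integral _ one_ne_zero]
  · exact fun i _ => integral_nonneg fun x => gaussianPDFReal_nonneg _ _ _
  · exact Integrable.fintype_prod fun i => (integrable_gaussianPDFReal 0 1).integrableOn
  · exact ae_of_all _ fun x => Finset.prod_nonneg fun i _ => gaussianPDFReal_nonneg _ _ _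

lemma prod_gaussianPDFReal_eq (x : E3) :
    ∏ i, gaussianPDFReal 0 1 (x i) =
      1 / √(8 * Real.pi ^ 3) * Real.exp (-(1 / 2) * ‖x‖ ^ 2) := by
  have hpi := Real.pi_pos
  have h8 : √(8 * Real.pi ^ 3) = √(2 * Real.pi) ^ 3 := by
    rw [Real.sqrt_eq_iff_mul_self_eq (by positivity) (by positivity), eq_comm]
    have h := Real.sq_sqrt (show (0 : ℝ) ≤ 2 * Real.pi by positivity)
    calc √(2 * Real.pi) ^ 3 * √(2 * Real.pi) ^ 3 = (√(2 * Real.pi) ^ 2) ^ 3 := by ring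
      _ = _ := by rw [h]; ring
  rw [EuclideanSpace.real_norm_sq_eq, h8]
  simp only [gaussianPDFReal_def, Fin.prod_univ_three, Fin.sum_univ_three, NNReal.coe_one]
  rw [show -(1 / 2) * (x 0 ^ 2 + x 1 ^ 2 + x 2 ^ 2) =
    -(x 0 - 0) ^ 2 / (2 * 1) + -(x 1 - 0) ^ 2 / (2 * 1) + -(x 2 - 0) ^ 2 / (2 * 1) by ring,
    Real.exp_add, Real.exp_add]
  simp only [mul_one]
  ring

lemma integrable_prod_gaussianPDFReal :
    Integrable fun x : E3 => ∏ i, gaussianPDFReal 0 1 (x i) := by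
  have h : Integrable fun x : Fin 3 → ℝ => ∏ i, gaussianPDFReal 0 1 (x i) :=
    Integrable.fintype_prod fun i => integrable_gaussianPDFReal 0 1
  exact (PiLp.volume_preserving_ofLp (Fin 3)).integrable_comp_of_integrable h

lemma stdGaussian_real_apply {s : Set E3} (hs : MeasurableSet s) :
    (stdGaussian E3).real s =
      ∫ x in s, 1 / √(8 * Real.pi ^ 3) * Real.exp (-(1 / 2) * ‖x‖ ^ 2) := by
  have hmeas : Measurable fun x : Fin 3 → ℝ =>
      ENNReal.ofReal (∏ i, gaussianPDFReal 0 1 (x i)) := by fun_prop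
  have hmap : stdGaussian E3 =
      volume.withDensity fun x : E3 => ENNReal.ofReal (∏ i, gaussianPDFReal 0 1 (x i)) := by
    ext t ht
    rw [← map_pi_eq_stdGaussian, Measure.map_apply (by fun_prop) ht,
      pi_gaussianReal_eq_withDensity, withDensity_apply _ ht,
      withDensity_apply _ (by measurability),
      ← (PiLp.volume_preserving_toLp (Fin 3)).setLIntegral_comp_preimage ht (by fun_prop)]
  simp_rw [← prod_gaussianPDFReal_eq]
  rw [measureReal_def, hmap, withDensity_apply _ hs, integral_eq_lintegral_of_nonneg_ae]
  · exact ae_of_all _ fun x => Finset.prod_nonneg fun i _ => gaussianPDFReal_nonneg _ _ _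
  · exact integrable_prod_gaussianPDFReal.integrableOn.aestronglyMeasurable

/-! ### Whitening and the collision event -/

lemma isUnit_sqrt {S : Matrix (Fin 3) (Fin 3) ℝ} (hS : S.PosDef) : IsUnit (CFC.sqrt S) := by
  have h := CFC.sqrt_mul_sqrt_self S hS.posSemidef.nonneg
  exact isUnit_of_mul_isUnit_left (h ▸ hS.isUnit)

lemma whiten_apply_sqrt {S : Matrix (Fin 3) (Fin 3) ℝ} (hS : S.PosDef) (x : E3) :
    whiten S (Matrix.toEuclideanCLM (𝕜 := ℝ) (CFC.sqrt S) x) = x := by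
  have hu := (Matrix.isUnit_iff_isUnit_det _).1 (isUnit_sqrt hS)
  rw [whiten, ← mul_apply_eq_comp, ← map_mul, Matrix.nonsing_inv_mul _ hu, map_one]
  rfl

lemma sqrt_apply_whiten {S : Matrix (Fin 3) (Fin 3) ℝ} (hS : S.PosDef) (x : E3) :
    Matrix.toEuclideanCLM (𝕜 := ℝ) (CFC.sqrt S) (whiten S x) = x := by
  have hu := (Matrix.isUnit_iff_isUnit_det _).1 (isUnit_sqrt hS)
  rw [whiten, ← mul_apply_eq_comp, ← map_mul, Matrix.mul_nonsing_inv _ hu, map_one]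
  rfl

/-- The Gaussian with covariance `S` is the image of the standard one under the square root of `S`,
whose inverse is `whiten S`; hence preimages under the former are images under the latter. -/
lemma multivariateGaussian_real_apply {S : Matrix (Fin 3) (Fin 3) ℝ} (hS : S.PosDef) {s : Set E3}
    (hs : MeasurableSet s) :
    (multivariateGaussian (0 : E3) S).real s = (stdGaussian E3).real (whiten S '' s) := by
  rw [measureReal_def, measureReal_def, multivariateGaussian,
    Measure.map_apply (by fun_prop) hs]
  congr 2
  ext x
  simp only [zero_add, Set.mem_preimage, Set.mem_image]
  exact ⟨fun h => ⟨_, h, whiten_apply_sqrt hS x⟩, by rintro ⟨y, hy, rfl⟩; rwa [sqrt_apply_whiten hS]⟩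

lemma IsConvexPolytope.isCompact {A : Set E3} (h : IsConvexPolytope A) : IsCompact A := by
  obtain ⟨s, rfl⟩ := h
  exact s.finite_toSet.isCompact_convexHull (𝕜 := ℝ)

lemma IsConvexPolytope.convex {A : Set E3} (h : IsConvexPolytope A) : Convex ℝ A := by
  obtain ⟨s, rfl⟩ := h
  exact convex_convexHull _ _

lemma collisionProb_eq_real (S : Matrix (Fin 3) (Fin 3) ℝ) (A B : Set E3) :
    collisionProb S A B = (multivariateGaussian (0 : E3) S).real (-A + B) := by
  rw [collisionProb]
  congr 1
  ext e
  simp only [Set.mem_add, Set.mem_neg]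
  constructor
  · rintro ⟨_, ⟨a, ha, rfl⟩, hb⟩
    exact ⟨-a, by simpa using ha, a + e, hb, by abel⟩
  · rintro ⟨a, ha, b, hb, rfl⟩
    exact ⟨b, ⟨-a, ha, by simp⟩, hb⟩

lemma interior_whitenedSum_nonempty {S : Matrix (Fin 3) (Fin 3) ℝ} (hS : S.PosDef) {A B : Set E3}
    (hAB : (interior (-A + B)).Nonempty) : (interior (whitenedSum S A B)).Nonempty := by
  have hs : Function.Surjective (whiten S) := fun x => ⟨_, whiten_apply_sqrt hS x⟩
  exact (hAB.image (whiten S)).mono (((whiten S).isOpenMap hs).image_interior_subset _)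

/-! ### Monte Carlo estimate -/

/-- Mean, variance and almost sure limit of the Monte Carlo estimate. -/
lemma mcEstimate_moments {Ω : Type*} [MeasurableSpace Ω] {μ : Measure Ω} [IsProbabilityMeasure μ]
    {P : Measure E3} {A B : Set E3} (hV : MeasurableSet (-A + B)) {ε : ℕ → Ω → E3}
    (hlaw : ∀ i, HasLaw (ε i) P μ) (hind : iIndepFun ε μ) :
    (∀ n : ℕ, 1 ≤ n → MemLp (mcEstimate A B ε n) 2 μ ∧
      ∫ ω, mcEstimate A B ε n ω ∂μ = P.real (-A + B) ∧
      variance (mcEstimate A B ε n) μ = P.real (-A + B) * (1 - P.real (-A + B)) / n) ∧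
    ∀ᵐ ω ∂μ, Tendsto (fun n => mcEstimate A B ε n ω) atTop (𝓝 (P.real (-A + B))) := by
  set V := -A + B with hVdef
  set f : E3 → ℝ := V.indicator fun _ => 1 with hf
  have hfm : Measurable f := measurable_const.indicator hV
  set X : ℕ → Ω → ℝ := fun i => f ∘ ε i with hX
  have hXm : ∀ i, AEMeasurable (X i) μ := fun i =>
    hfm.comp_aemeasurable (hlaw i).aemeasurable
  have hXL : ∀ i, MemLp (X i) 2 μ := fun i => by
    refine MemLp.of_bound (hXm i).aestronglyMeasurable 1 (ae_of_all _ fun ω => ?_)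
    simp only [hX, hf, Function.comp, Set.indicator]
    split_ifs <;> simp
  have hXint : ∀ i, ∫ ω, X i ω ∂μ = P.real V := fun i => by
    have := (hlaw i).integral_comp (f := f) hfm.aestronglyMeasurable
    rw [this, hf, integral_indicator_const _ hV]
    simp
  have hXvar : ∀ i, variance (X i) μ = P.real V * (1 - P.real V) := fun i => by
    -- An indicator is idempotent, so its second moment equals its mean p and the variance is p -
    -- p².
    have hsq : (X i) ^ 2 = X i := by
      ext ω
      simp only [hX, hf, Function.comp, Set.indicator, Pi.pow_apply]
      split_ifs <;> simp
    rw [variance_eq_sub (hXL i), hsq, hXint]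
    ring
  -- Pairwise independence suffices both for additivity of the variance and for the strong law.
  have hXind : Pairwise fun i j => X i ⟂ᵢ[μ] X j := fun i j hij =>
    (hind.indepFun hij).comp hfm hfm
  have hmc : ∀ n, mcEstimate A B ε n = fun ω => (1 / (n : ℝ)) * (∑ i ∈ Finset.range n, X i) ω := by
    intro n
    ext ω
    simp [mcEstimate, hX, hf, hVdef]
  refine ⟨fun n hn => ?_, ?_⟩
  · have hn0 : (n : ℝ) ≠ 0 := by positivity
    have hsumL : MemLp (∑ i ∈ Finset.range n, X i) 2 μ := memLp_finsetSum' _ fun i _ => hXL i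
    rw [hmc]
    refine ⟨hsumL.const_mul _, ?_, ?_⟩
    · rw [integral_const_mul]
      simp only [Finset.sum_apply]
      rw [integral_finsetSum _ fun i _ => (hXL i).integrable one_le_two]
      simp only [hXint, Finset.sum_const, Finset.card_range, nsmul_eq_mul]
      field_simp
    · rw [variance_const_mul, IndepFun.variance_sum (fun i _ => hXL i) fun i _ j _ hij => hXind hij]
      simp only [hXvar, Finset.sum_const, Finset.card_range, nsmul_eq_mul]
      field_simp
  · have hident : ∀ i, IdentDistrib (X i) (X 0) μ μ := fun i =>
      (IdentDistrib.mk (hlaw i).aemeasurable (hlaw 0).aemeasurable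
        ((hlaw i).map_eq.trans (hlaw 0).map_eq.symm)).comp hfm
    filter_upwards [strong_law_ae_real X ((hXL 0).integrable one_le_two) hXind hident] with ω hω
    rw [hXint] at hω
    refine hω.congr fun n => ?_
    rw [hmc]
    simp [div_eq_inv_mul]

/-! ### Areas of plane triangles -/

lemma volume_unitTriangle :
    volume {y : Fin 2 → ℝ | 0 ≤ y 0 ∧ 0 ≤ y 1 ∧ y 0 + y 1 ≤ 1} = ENNReal.ofReal (1 / 2) := by
  set D : Set (ℝ × ℝ) := {p | 0 ≤ p.1 ∧ 0 ≤ p.2 ∧ p.1 + p.2 ≤ 1} with hD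
  have hDm : MeasurableSet D :=
    (measurableSet_le measurable_const measurable_fst).inter
      ((measurableSet_le measurable_const measurable_snd).inter
        (measurableSet_le (measurable_fst.add measurable_snd) measurable_const))
  have h1 : {y : Fin 2 → ℝ | 0 ≤ y 0 ∧ 0 ≤ y 1 ∧ y 0 + y 1 ≤ 1} =
      MeasurableEquiv.finTwoArrow ⁻¹' D := by
    ext y
    simp [hD, MeasurableEquiv.finTwoArrow]
  rw [h1, (volume_preserving_finTwoArrow ℝ).measure_preimage hDm.nullMeasurableSet,
    Measure.volume_eq_prod, Measure.prod_apply hDm]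
  have h2 : ∀ x : ℝ, volume (Prod.mk x ⁻¹' D) =
      (Set.Icc (0 : ℝ) 1).indicator (fun x => ENNReal.ofReal (1 - x)) x := fun x => by
    by_cases hx : x ∈ Set.Icc (0 : ℝ) 1
    · have : Prod.mk x ⁻¹' D = Set.Icc 0 (1 - x) := by
        ext t
        simp only [hD, Set.mem_preimage, Set.mem_ofPred_eq, Set.mem_Icc]
        exact ⟨fun h => ⟨h.2.1, by linarith⟩, fun h => ⟨hx.1, h.1, by linarith⟩⟩
      rw [this, Real.volume_Icc, Set.indicator_of_mem hx, sub_zero]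
    · have : Prod.mk x ⁻¹' D = ∅ := by
        ext t
        simp only [hD, Set.mem_preimage, Set.mem_ofPred_eq, Set.mem_empty_iff_false, iff_false]
        exact fun h => hx ⟨h.1, by linarith [h.2.1, h.2.2]⟩
      rw [this, measure_empty, Set.indicator_of_notMem hx]
  simp_rw [h2]
  rw [lintegral_indicator measurableSet_Icc, ← ofReal_integral_eq_lintegral_ofReal]
  · rw [integral_Icc_eq_integral_Ioc, ← intervalIntegral.integral_of_le zero_le_one,
      intervalIntegral.integral_sub (by simp) (by simp)]
    norm_num
  · exact ContinuousOn.integrableOn_compact isCompact_Icc (by fun_prop)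
  · exact (ae_restrict_iff' measurableSet_Icc).2 (ae_of_all _ fun x hx => sub_nonneg.2 hx.2)

/-- These are barycentric coordinates with weights 1 - y₀ - y₁, y₀, y₁. The points need not be
affinely independent, which matters because a triangle may project to a segment. -/
lemma convexHull_range_eq_image_unitTriangle (p : Fin 3 → Fin 2 → ℝ) :
    convexHull ℝ (Set.range p) =
      (fun y : Fin 2 → ℝ => p 0 + (y 0 • (p 1 - p 0) + y 1 • (p 2 - p 0))) ''
        {y : Fin 2 → ℝ | 0 ≤ y 0 ∧ 0 ≤ y 1 ∧ y 0 + y 1 ≤ 1} := by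
  apply Set.Subset.antisymm
  · refine convexHull_min ?_ ?_
    · rintro _ ⟨j, rfl⟩
      fin_cases j
      · exact ⟨![0, 0], by simp, by simp⟩
      · exact ⟨![1, 0], by simp, by simp⟩
      · exact ⟨![0, 1], by simp, by simp⟩
    · rintro _ ⟨y, ⟨h0, h1, h2⟩, rfl⟩ _ ⟨z, ⟨k0, k1, k2⟩, rfl⟩ a b ha hb hab
      refine ⟨a • y + b • z, ⟨?_, ?_, ?_⟩, ?_⟩
      · simp only [Pi.add_apply, Pi.smul_apply, smul_eq_mul]; positivity
      · simp only [Pi.add_apply, Pi.smul_apply, smul_eq_mul]; positivity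
      · simp only [Pi.add_apply, Pi.smul_apply, smul_eq_mul]; nlinarith
      · ext k
        simp only [Pi.add_apply, Pi.smul_apply, smul_eq_mul, Pi.sub_apply]
        linear_combination (-(p 0 k)) * hab
  · rintro _ ⟨y, ⟨h0, h1, h2⟩, rfl⟩
    have hc := convex_convexHull ℝ (Set.range p)
    have hp : ∀ j, p j ∈ convexHull ℝ (Set.range p) := fun j => subset_convexHull ℝ _ ⟨j, rfl⟩
    have := hc.sum_mem (t := Finset.univ) (w := ![1 - y 0 - y 1, y 0, y 1]) (z := p)
      (by intro i _; fin_cases i <;> simp <;> linarith)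
      (by simp [Fin.sum_univ_three]; ring) fun i _ => hp i
    convert this using 1
    simp only [Fin.sum_univ_three, Matrix.cons_val]
    module

lemma volume_convexHull_triangle (p : Fin 3 → Fin 2 → ℝ) :
    volume.real (convexHull ℝ (Set.range p)) =
      1 / 2 * |(p 1 0 - p 0 0) * (p 2 1 - p 0 1) - (p 1 1 - p 0 1) * (p 2 0 - p 0 0)| := by
  set M : Matrix (Fin 2) (Fin 2) ℝ :=
    !![p 1 0 - p 0 0, p 2 0 - p 0 0; p 1 1 - p 0 1, p 2 1 - p 0 1] with hM
  have h1 : (fun y : Fin 2 → ℝ => p 0 + (y 0 • (p 1 - p 0) + y 1 • (p 2 - p 0))) =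
      (fun y => p 0 + y) ∘ Matrix.toLin' M := by
    ext y k
    fin_cases k <;> simp [hM, dotProduct, Fin.sum_univ_two] <;> ring
  rw [convexHull_range_eq_image_unitTriangle, h1, Set.image_comp, Set.image_add_left,
    measureReal_def, measure_preimage_add, Measure.addHaar_image_linearMap, volume_unitTriangle,
    LinearMap.det_toLin', Matrix.det_fin_two, ← ENNReal.ofReal_mul (abs_nonneg _),
    ENNReal.toReal_ofReal (by positivity)]
  simp only [hM, Matrix.of_apply, Matrix.cons_val', Matrix.cons_val_zero, Matrix.cons_val_one,
    Matrix.cons_val_fin_one]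
  rw [mul_comm]
  congr 2
  ring

lemma volume_affineSpan_pair_eq_zero (q : Fin 2 → Fin 2 → ℝ) :
    volume (affineSpan ℝ (Set.range q) : Set (Fin 2 → ℝ)) = 0 := by
  refine Measure.addHaar_affineSubspace _ _ fun h => ?_
  have h1 := finrank_vectorSpan_range_le ℝ q (n := 1) (by simp)
  rw [← direction_affineSpan, h, AffineSubspace.direction_top, finrank_top] at h1
  simp at h1

/-! ### Coordinates adapted to a direction -/

variable (b : OrthonormalBasis (Fin 3) ℝ E3)

/-- The orthogonal projection along the first vector of an orthonormal basis, in coordinates. -/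
noncomputable def shadow : E3 →L[ℝ] (Fin 2 → ℝ) :=
  ContinuousLinearMap.pi fun i => innerSL ℝ (b i.succ)

@[simp] lemma shadow_apply (x : E3) (i : Fin 2) : shadow b x i = ⟪b i.succ, x⟫ := rfl

/-- The point with given height along the first basis vector and given projection. -/
noncomputable def lift (t : ℝ) (y : Fin 2 → ℝ) : E3 := b.repr.symm (WithLp.toLp 2 (Fin.cons t y))

lemma inner_lift (t : ℝ) (y : Fin 2 → ℝ) : ⟪b 0, lift b t y⟫ = t := by
  rw [← b.repr_apply_apply, lift, LinearIsometryEquiv.apply_symm_apply]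
  rfl

lemma shadow_lift (t : ℝ) (y : Fin 2 → ℝ) : shadow b (lift b t y) = y := by
  ext i
  rw [shadow_apply, ← b.repr_apply_apply, lift, LinearIsometryEquiv.apply_symm_apply]
  rfl

lemma lift_inner_shadow (x : E3) : lift b ⟪b 0, x⟫ (shadow b x) = x := by
  rw [lift, LinearIsometryEquiv.symm_apply_eq]
  ext i
  rw [b.repr_apply_apply]
  refine Fin.cases ?_ (fun j => ?_) i <;> rfl

lemma lift_sub_lift (s t : ℝ) (y : Fin 2 → ℝ) : lift b s y - lift b t y = (s - t) • b 0 := by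
  apply b.repr.injective
  simp only [lift, map_sub, LinearIsometryEquiv.apply_symm_apply, map_smul, b.repr_self]
  ext i
  refine Fin.cases ?_ (fun j => ?_) i <;> simp

lemma shadow_surjective : Function.Surjective (shadow b) := fun y => ⟨lift b 0 y, shadow_lift b 0 y⟩

lemma measurePreserving_lift :
    MeasurePreserving (fun p : ℝ × (Fin 2 → ℝ) => lift b p.1 p.2) := by
  have h : (fun p : ℝ × (Fin 2 → ℝ) => (Fin.cons p.1 p.2 : Fin 3 → ℝ)) =
      (MeasurableEquiv.piFinSuccAbove (fun _ : Fin 3 => ℝ) 0).symm := by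
    ext p i
    refine Fin.cases ?_ (fun j => ?_) i <;> simp [MeasurableEquiv.piFinSuccAbove]
  refine b.measurePreserving_repr_symm.comp ((PiLp.volume_preserving_toLp (Fin 3)).comp ?_)
  rw [h]
  exact (volume_preserving_piFinSuccAbove (fun _ : Fin 3 => ℝ) 0).symm _

lemma continuous_lift (y : Fin 2 → ℝ) : Continuous fun t => lift b t y := by
  unfold lift
  refine b.repr.symm.continuous.comp ((PiLp.continuous_toLp 2 _).comp ?_)
  exact continuous_pi fun i => by refine Fin.cases ?_ (fun j => ?_) i <;> simp <;> fun_prop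

/-- Fubini's theorem along a direction. -/
lemma integral_eq_integral_fibers {f : E3 → ℝ} (hf : Integrable f) :
    Integrable (fun y => ∫ t, f (lift b t y)) ∧ ∫ x, f x = ∫ y, ∫ t, f (lift b t y) := by
  have h := (measurePreserving_lift b).integrable_comp_of_integrable hf
  rw [Measure.volume_eq_prod] at h
  refine ⟨h.integral_prod_right, ?_⟩
  rw [← (measurePreserving_lift b).map_eq,
    integral_map (measurePreserving_lift b).measurable.aemeasurable
      (by rw [(measurePreserving_lift b).map_eq]; exact hf.aestronglyMeasurable)]
  rw [Measure.volume_eq_prod]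
  exact integral_prod_symm _ h

/-! ### Projected triangles -/

lemma shadow_image_closedInterior (t : Affine.Triangle ℝ E3) :
    shadow b '' t.closedInterior = convexHull ℝ (Set.range fun j => shadow b (t.points j)) := by
  rw [← Affine.Simplex.convexHull_eq_closedInterior]
  have := (shadow b).toLinearMap.image_convexHull (Set.range t.points)
  rw [← Set.range_comp] at this
  exact this

/-- The relative boundary consists of the three edges, and each edge projects into the affine span
of two points of the plane, a null set. -/
lemma volume_shadow_boundary (t : Affine.Triangle ℝ E3) :
    volume (shadow b '' (t.closedInterior \ t.interior)) = 0 := by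
  rw [Affine.Simplex.closedInterior_sdiff_interior, Set.image_iUnion]
  refine measure_iUnion_null fun i => ?_
  refine measure_mono_null ?_
    (volume_affineSpan_pair_eq_zero fun j => shadow b ((t.faceOpposite i).points j))
  rintro _ ⟨x, hx, rfl⟩
  have hx' := Affine.Simplex.closedInterior_subset_affineSpan hx
  have := AffineSubspace.mem_map_of_mem (shadow b).toLinearMap.toAffineMap hx'
  rw [AffineSubspace.map_span, ← Set.range_comp] at this
  exact this

/-- Expressing the rows b₀, u, v in the basis `b` leaves a matrix with first row (1, 0, 0), whose
determinant is the planar minor; in standard coordinates the determinant is the triple product. The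
squares absorb the unknown orientation of `b`. -/
lemma det_shadow_sq (u v : E3) :
    (shadow b u 0 * shadow b v 1 - shadow b u 1 * shadow b v 0) ^ 2 =
      ⟪WithLp.toLp 2 (crossProduct u.ofLp v.ofLp), b 0⟫ ^ 2 := by
  set M : Matrix (Fin 3) (Fin 3) ℝ := Matrix.of ![(b 0).ofLp, u.ofLp, v.ofLp] with hM
  set Q : Matrix (Fin 3) (Fin 3) ℝ := Matrix.of fun k j => b j k with hQ
  have hQQ : Qᵀ * Q = 1 := by
    ext i j
    have := orthonormal_iff_ite.1 b.orthonormal i j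
    rw [Matrix.one_apply, ← this]
    simp [Matrix.mul_apply, hQ, PiLp.inner_apply, mul_comm]
  have hdet : Q.det ^ 2 = 1 := by
    have := congrArg Matrix.det hQQ
    rwa [Matrix.det_mul, Matrix.det_transpose, Matrix.det_one, ← sq] at this
  have hMQ : M * Q = !![1, 0, 0; ⟪b 0, u⟫, shadow b u 0, shadow b u 1;
      ⟪b 0, v⟫, shadow b v 0, shadow b v 1] := by
    have h0 : ∀ j, ⟪b j, b 0⟫ = if j = 0 then 1 else 0 := fun j =>
      orthonormal_iff_ite.1 b.orthonormal j 0
    have hrow : ∀ (i j) (w : E3), M i = w.ofLp → (M * Q) i j = ⟪b j, w⟫ := fun i j w hw => by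
      simp [Matrix.mul_apply, hQ, PiLp.inner_apply, hw]
    ext i j
    fin_cases i
    · rw [show ((⟨0, by norm_num⟩ : Fin 3)) = 0 from rfl, hrow 0 j (b 0) rfl, h0]
      fin_cases j <;> simp
    · rw [show ((⟨1, by norm_num⟩ : Fin 3)) = 1 from rfl, hrow 1 j u rfl]
      fin_cases j <;> simp
    · rw [show ((⟨2, by norm_num⟩ : Fin 3)) = 2 from rfl, hrow 2 j v rfl]
      fin_cases j <;> simp
  have h1 : (M * Q).det = shadow b u 0 * shadow b v 1 - shadow b u 1 * shadow b v 0 := by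
    rw [hMQ, Matrix.det_fin_three]
    simp
  have h2 : M.det = ⟪WithLp.toLp 2 (crossProduct u.ofLp v.ofLp), b 0⟫ := by
    rw [Matrix.det_fin_three]
    simp [hM, PiLp.inner_apply, Fin.sum_univ_three, cross_apply]
    ring
  rw [← h1, ← h2, Matrix.det_mul, mul_pow, hdet, mul_one]

/-- Since `n` is a unit vector orthogonal to u and v, the cross product is a multiple of `n`, even
when u and v are dependent. -/
lemma abs_inner_cross_eq {u v n : E3} (hn : ‖n‖ = 1) (hu : ⟪u, n⟫ = 0) (hv : ⟪v, n⟫ = 0) (d : E3) :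
    |⟪WithLp.toLp 2 (crossProduct u.ofLp v.ofLp), d⟫| =
      ‖WithLp.toLp 2 (crossProduct u.ofLp v.ofLp)‖ * |⟪d, n⟫| := by
  set w : E3 := WithLp.toLp 2 (crossProduct u.ofLp v.ofLp) with hw
  have hw0 : w 0 = u 1 * v 2 - u 2 * v 1 := by simp [hw, cross_apply]
  have hw1 : w 1 = u 2 * v 0 - u 0 * v 2 := by simp [hw, cross_apply]
  have hw2 : w 2 = u 0 * v 1 - u 1 * v 0 := by simp [hw, cross_apply]
  have hn2 : n 0 ^ 2 + n 1 ^ 2 + n 2 ^ 2 = 1 := by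
    have := EuclideanSpace.real_norm_sq_eq n
    rw [hn, Fin.sum_univ_three] at this
    linarith
  simp only [PiLp.inner_apply, Fin.sum_univ_three, RCLike.inner_apply, conj_trivial] at hu hv
  -- The next three identities are the coordinates of n × w = 0.
  have h01 : n 0 * w 1 = n 1 * w 0 := by
    rw [hw0, hw1]; linear_combination v 2 * (-hu) + u 2 * hv
  have h02 : n 0 * w 2 = n 2 * w 0 := by
    rw [hw0, hw2]; linear_combination v 1 * hu - u 1 * hv
  have h12 : n 1 * w 2 = n 2 * w 1 := by
    rw [hw1, hw2]; linear_combination v 0 * (-hu) + u 0 * hv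
  have key : w = ⟪w, n⟫ • n := by
    have hi : ⟪w, n⟫ = n 0 * w 0 + n 1 * w 1 + n 2 * w 2 := by
      simp [PiLp.inner_apply, Fin.sum_univ_three]
    ext k
    rw [PiLp.smul_apply, smul_eq_mul, hi]
    fin_cases k
    · show w 0 = _ * n 0
      linear_combination (-w 0) * hn2 - n 1 * h01 - n 2 * h02
    · show w 1 = _ * n 1
      linear_combination (-w 1) * hn2 + n 0 * h01 - n 2 * h12
    · show w 2 = _ * n 2
      linear_combination (-w 2) * hn2 + n 0 * h02 + n 1 * h12
  have hnorm : ‖w‖ = |⟪w, n⟫| := by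
    conv_lhs => rw [key, norm_smul, hn, mul_one, Real.norm_eq_abs]
  rw [hnorm, ← abs_mul]
  conv_lhs => rw [key, real_inner_smul_left, real_inner_comm d n]

/-- The area of the projection of a triangle. -/
lemma volume_shadow_triangle {t : Affine.Triangle ℝ E3} {n : E3} (hn : ‖n‖ = 1)
    (ho : ∀ j k, ⟪t.points j - t.points k, n⟫ = 0) :
    volume.real (shadow b '' t.closedInterior) = |⟪b 0, n⟫| * triangleArea t := by
  have h := abs_inner_cross_eq hn (ho 1 0) (ho 2 0) (b 0)
  have h2 := det_shadow_sq b (t.points 1 - t.points 0) (t.points 2 - t.points 0)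
  rw [sq_eq_sq_iff_abs_eq_abs, h] at h2
  simp only [map_sub, Pi.sub_apply] at h2
  rw [shadow_image_closedInterior, volume_convexHull_triangle, h2, triangleArea]
  ring

/-! ### Fibers of a convex body over its projection -/

/-- The fiber of a compact convex set over a point of its projection is a segment. -/
lemma exists_fiber_eq_Icc {V : Set E3} (hc : IsCompact V) (hV : Convex ℝ V) {y : Fin 2 → ℝ}
    (hy : y ∈ shadow b '' V) : ∃ s t : ℝ, s ≤ t ∧ {r | lift b r y ∈ V} = Set.Icc s t := by
  -- As the image of a slice of `V` under the height functional, the fiber inherits compactness and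
  -- convexity.
  have himg : {r | lift b r y ∈ V} = (fun x => ⟪b 0, x⟫) '' (V ∩ shadow b ⁻¹' {y}) := by
    ext r
    constructor
    · exact fun hr => ⟨_, ⟨hr, shadow_lift b r y⟩, inner_lift b r y⟩
    · rintro ⟨x, ⟨hx, rfl⟩, rfl⟩
      rw [Set.mem_ofPred_eq, lift_inner_shadow]
      exact hx
  have hcomp : IsCompact {r | lift b r y ∈ V} := by
    rw [himg]
    exact (hc.inter_right (isClosed_singleton.preimage (shadow b).continuous)).image (by fun_prop)
  have hconv : Convex ℝ {r | lift b r y ∈ V} := by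
    have hconv' : Convex ℝ (V ∩ shadow b ⁻¹' {y}) :=
      hV.inter ((convex_singleton y).linear_preimage (shadow b).toLinearMap)
    rw [himg]
    exact hconv'.linear_image (innerSL ℝ (b 0)).toLinearMap
  have hne : {r | lift b r y ∈ V}.Nonempty := by
    obtain ⟨x, hx, rfl⟩ := hy
    exact ⟨⟪b 0, x⟫, by rwa [Set.mem_ofPred_eq, lift_inner_shadow]⟩
  have h := eq_Icc_of_connected_compact ⟨hne, hconv.isPreconnected⟩ hcomp
  refine ⟨_, _, ?_, h⟩
  rw [h] at hne
  exact Set.nonempty_Icc.1 hne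

/-- Interior points of `V` pull back to interior points of the fiber. Thus the ends of a fiber lie
on the frontier, and a fiber meeting the interior has positive length. -/
lemma mem_Ioo_of_lift_mem_interior {V : Set E3} {y : Fin 2 → ℝ} {s t : ℝ}
    (h : {r | lift b r y ∈ V} = Set.Icc s t) {r : ℝ} (hr : lift b r y ∈ interior V) :
    r ∈ Set.Ioo s t := by
  rw [← interior_Icc, ← h]
  exact mem_interior.2 ⟨{r | lift b r y ∈ interior V}, fun _ h => interior_subset (s := V) h,
    isOpen_interior.preimage (continuous_lift b y), hr⟩

/-- The projection of the interior is open, convex and dense in the projection of `V`, and an open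
convex set is the interior of its closure. -/
lemma interior_shadow_subset {V : Set E3} (hc : IsCompact V) (hV : Convex ℝ V)
    (hne : (interior V).Nonempty) :
    interior (shadow b '' V) ⊆ shadow b '' interior V := by
  have hopen : IsOpen (shadow b '' interior V) :=
    (shadow b).isOpenMap (shadow_surjective b) _ isOpen_interior
  have hconv : Convex ℝ (shadow b '' interior V) :=
    hV.interior.linear_image (shadow b).toLinearMap
  have h1 : shadow b '' V ⊆ closure (shadow b '' interior V) := by
    have h := image_closure_subset_closure_image (s := interior V) (shadow b).continuous
    rwa [hV.closure_interior_eq_closure_of_nonempty_interior hne, hc.isClosed.closure_eq] at h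
  have h2 := hconv.interior_closure_eq_interior_of_nonempty_interior
    (by rw [hopen.interior_eq]; exact hne.image _)
  rw [hopen.interior_eq] at h2
  exact h2 ▸ interior_mono h1

/-! ### One-sided divergence theorem -/

/-- The flux inequality on a single fiber: the increment of a nonnegative function along the fiber
is at most the sum of the contributions of the boundary triangles which meet the fiber. -/
lemma fiber_increment_le {V : Set E3} (hc : IsCompact V)
    {ι : Type*} [Fintype ι] {T : ι → Affine.Triangle ℝ E3} {ν : ι → E3}
    (hT : IsBoundaryTriangulation V T) (hν : ∀ i, IsOutwardUnitNormal V (T i) (ν i))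
    {g : ℝ → ℝ} (hg0 : ∀ x, 0 ≤ g x) {K : ι → ℝ}
    (hK : ∀ i, ∀ x ∈ (T i).closedInterior, g ⟪b 0, x⟫ * ⟪b 0, ν i⟫ ≤ K i)
    {y : Fin 2 → ℝ} {s t : ℝ} (hst : s < t) (hfib : {r | lift b r y ∈ V} = Set.Icc s t)
    (hvert : ∀ i, ⟪b 0, ν i⟫ = 0 → y ∉ shadow b '' (T i).closedInterior)
    (hedge : ∀ i, y ∉ shadow b '' ((T i).closedInterior \ (T i).interior)) :
    g t - g s ≤ ∑ i, (shadow b '' (T i).closedInterior).indicator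
      (fun _ => K i / |⟪b 0, ν i⟫|) y := by
  classical
  have hTV : ∀ i, (T i).closedInterior ⊆ V := fun i =>
    (Set.subset_iUnion (fun i => (T i).closedInterior) i).trans
      (hT.cover ▸ hc.isClosed.frontier_subset)
  have hsV : lift b s y ∈ V := (Set.ext_iff.1 hfib s).2 (Set.left_mem_Icc.2 hst.le)
  have htV : lift b t y ∈ V := (Set.ext_iff.1 hfib t).2 (Set.right_mem_Icc.2 hst.le)
  -- The plane of each triangle supports `V`, so along the fiber the body lies below an
  -- upward-facing triangle and above a downward-facing one.
  have hside : ∀ i, ∀ r₁ r₂, lift b r₁ y ∈ (T i).closedInterior → lift b r₂ y ∈ V →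
      (r₂ - r₁) * ⟪b 0, ν i⟫ ≤ 0 := by
    intro i r₁ r₂ h₁ h₂
    have hplane : ⟪lift b r₁ y - (T i).points 0, ν i⟫ = 0 := by
      have hsub : (T i).closedInterior ⊆ {x | ⟪x - (T i).points 0, ν i⟫ = 0} := by
        rw [← Affine.Simplex.convexHull_eq_closedInterior]
        refine convexHull_min ?_ ?_
        · rintro _ ⟨j, rfl⟩
          exact (hν i).orthogonal j 0
        · intro x hx z hz p q _ _ hpq
          simp only [Set.mem_ofPred_eq, inner_sub_left, inner_add_left, real_inner_smul_left,
            sub_eq_zero] at hx hz ⊢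
          rw [hx, hz, ← add_mul, hpq, one_mul]
      exact hsub h₁
    have h3 := (hν i).outward _ h₂
    rw [← real_inner_smul_left, ← lift_sub_lift b r₂ r₁ y]
    rw [inner_sub_left] at h3 hplane ⊢
    linarith
  -- the top of the fiber lies on an upper triangle
  obtain ⟨i₀, hi₀⟩ : ∃ i, lift b t y ∈ (T i).closedInterior := by
    have : lift b t y ∈ frontier V := by
      rw [hc.isClosed.frontier_eq]
      exact ⟨htV, fun h => (mem_Ioo_of_lift_mem_interior b hfib h).2.false⟩
    rw [← hT.cover] at this
    exact Set.mem_iUnion.1 this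
  have hmem : ∀ {i r}, lift b r y ∈ (T i).closedInterior →
      y ∈ shadow b '' (T i).closedInterior := fun {i r} h => ⟨_, h, shadow_lift b r y⟩
  have hlift : ∀ {i}, y ∈ shadow b '' (T i).closedInterior →
      ∃ r, lift b r y ∈ (T i).closedInterior := by
    rintro i ⟨x, hx, rfl⟩
    exact ⟨⟪b 0, x⟫, by rwa [lift_inner_shadow]⟩
  have hi₀pos : 0 < ⟪b 0, ν i₀⟫ := by
    have h1 := hside i₀ t s hi₀ hsV
    have h2 : ⟪b 0, ν i₀⟫ ≠ 0 := fun h => hvert i₀ h (hmem hi₀)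
    exact lt_of_le_of_ne (by nlinarith) h2.symm
  -- every lower triangle passes through the bottom of the fiber
  have hbot : ∀ i, ⟪b 0, ν i⟫ < 0 → y ∈ shadow b '' (T i).closedInterior →
      lift b s y ∈ (T i).closedInterior := by
    intro i hi hy
    obtain ⟨r, hr⟩ := hlift hy
    have h1 := hside i r s hr hsV
    have h2 : s ≤ r := ((Set.ext_iff.1 hfib r).1 (hTV i hr)).1
    have h3 : r = s := by nlinarith
    rwa [h3] at hr
  set low : Finset ι := Finset.univ.filter fun i =>
    ⟪b 0, ν i⟫ < 0 ∧ y ∈ shadow b '' (T i).closedInterior with hlow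
  -- Two lower triangles would share the bottom point, which is interior to both because `y` avoids
  -- the projected edges; this contradicts non-overlap.
  have hcard : low.card ≤ 1 := by
    refine Finset.card_le_one.2 fun i hi j hj => ?_
    rw [hlow, Finset.mem_filter] at hi hj
    by_contra hij
    have hint : ∀ k, lift b s y ∈ (T k).closedInterior → lift b s y ∈ (T k).interior :=
      fun k hk => by
        by_contra h
        exact hedge k ⟨_, ⟨hk, h⟩, shadow_lift b s y⟩
    exact Set.disjoint_left.1 (hT.nonoverlap hij) (hint i (hbot i hi.2.1 hi.2.2))
      (hint j (hbot j hj.2.1 hj.2.2))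
  -- Upward triangles contribute nonnegatively as g ≥ 0, so it is enough that one, `i₀`, pays for g
  -- t and any others are harmless. A lower triangle contributes at least -g s, so what matters is
  -- that there is at most one.
  have hterm : ∀ i, (if i = i₀ then g t else 0) + (if i ∈ low then -g s else 0) ≤
      (shadow b '' (T i).closedInterior).indicator (fun _ => K i / |⟪b 0, ν i⟫|) y := by
    intro i
    by_cases hy : y ∈ shadow b '' (T i).closedInterior
    · rw [Set.indicator_of_mem hy]
      rcases lt_trichotomy ⟪b 0, ν i⟫ 0 with hi | hi | hi
      · have hne : i ≠ i₀ := by rintro rfl; exact hi.not_gt hi₀pos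
        have hil : i ∈ low := Finset.mem_filter.2 ⟨Finset.mem_univ i, hi, hy⟩
        have h1 := hK i _ (hbot i hi hy)
        rw [inner_lift] at h1
        rw [if_neg hne, if_pos hil, abs_of_neg hi, le_div_iff₀ (neg_pos.2 hi)]
        linarith
      · exact absurd hy (hvert i hi)
      · have hil : i ∉ low := fun h => hi.not_gt (Finset.mem_filter.1 h).2.1
        rw [if_neg hil, add_zero, abs_of_pos hi, le_div_iff₀ hi]
        split_ifs with h
        · subst h
          simpa only [inner_lift] using hK i _ hi₀
        · obtain ⟨r, hr⟩ := hlift hy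
          rw [zero_mul]
          exact (mul_nonneg (hg0 _) hi.le).trans (hK i _ hr)
    · have hne : i ≠ i₀ := by rintro rfl; exact hy (hmem hi₀)
      have hil : i ∉ low := fun h => hy (Finset.mem_filter.1 h).2.2
      rw [Set.indicator_of_notMem hy, if_neg hne, if_neg hil, add_zero]
  refine le_trans ?_ (Finset.sum_le_sum fun i _ => hterm i)
  rw [Finset.sum_add_distrib, Finset.sum_ite_eq' Finset.univ i₀ fun _ => g t,
    if_pos (Finset.mem_univ _), Finset.sum_ite_mem, Finset.univ_inter, Finset.sum_const,
    nsmul_eq_mul, sub_eq_add_neg]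
  have : (low.card : ℝ) ≤ 1 := by exact_mod_cast hcard
  nlinarith [hg0 s]

/-- A one-sided divergence theorem for the field `g (x · b₀) b₀` on a triangulated convex body. -/
lemma integral_deriv_le_sum_area {V : Set E3} (hc : IsCompact V) (hV : Convex ℝ V)
    (hne : (interior V).Nonempty)
    {ι : Type*} [Fintype ι] {T : ι → Affine.Triangle ℝ E3} {ν : ι → E3}
    (hT : IsBoundaryTriangulation V T) (hν : ∀ i, IsOutwardUnitNormal V (T i) (ν i))
    {g φ : ℝ → ℝ} (hg0 : ∀ x, 0 ≤ g x) (hg : ∀ x, HasDerivAt g (φ x) x) (hφ : Continuous φ)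
    {K : ι → ℝ} (hK : ∀ i, ∀ x ∈ (T i).closedInterior, g ⟪b 0, x⟫ * ⟪b 0, ν i⟫ ≤ K i) :
    ∫ x in V, φ ⟪b 0, x⟫ ≤ ∑ i, K i * triangleArea (T i) := by
  have hTc : ∀ i, IsCompact (shadow b '' (T i).closedInterior) := fun i =>
    (T i).isCompact_closedInterior.image (shadow b).continuous
  have hTV : ∀ i, (T i).closedInterior ⊆ V := fun i =>
    (Set.subset_iUnion (fun i => (T i).closedInterior) i).trans
      (hT.cover ▸ hc.isClosed.frontier_subset)
  have harea : ∀ i, volume.real (shadow b '' (T i).closedInterior) =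
      |⟪b 0, ν i⟫| * triangleArea (T i) := fun i =>
    volume_shadow_triangle b (hν i).unit (hν i).orthogonal
  have harea0 : ∀ i, 0 ≤ triangleArea (T i) := fun i => by unfold triangleArea; positivity
  have hint : Integrable (V.indicator fun x => φ ⟪b 0, x⟫) :=
    (ContinuousOn.integrableOn_compact hc (by fun_prop)).integrable_indicator hc.measurableSet
  obtain ⟨hFint, hF⟩ := integral_eq_integral_fibers b hint
  rw [← integral_indicator hc.measurableSet, hF]
  have hGint : ∀ i, Integrable ((shadow b '' (T i).closedInterior).indicator
      fun _ => K i / |⟪b 0, ν i⟫|) := fun i =>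
    (integrableOn_const (hTc i).measure_lt_top.ne).integrable_indicator (hTc i).measurableSet
  have hle : ∫ y, ∫ r, V.indicator (fun x => φ ⟪b 0, x⟫) (lift b r y) ≤
      ∫ y, ∑ i, (shadow b '' (T i).closedInterior).indicator
        (fun _ => K i / |⟪b 0, ν i⟫|) y := by
    refine integral_mono_ae hFint (integrable_finsetSum _ fun i _ => hGint i) ?_
    -- Triangles parallel to b₀ project to null sets, because the projected area carries the factor
    -- |⟪b 0, ν i⟫|.
    have hvert : ∀ᵐ y : Fin 2 → ℝ, ∀ i, ⟪b 0, ν i⟫ = 0 →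
        y ∉ shadow b '' (T i).closedInterior := by
      refine ae_all_iff.2 fun i => ?_
      by_cases hi : ⟪b 0, ν i⟫ = 0
      · have h := harea i
        rw [hi, abs_zero, zero_mul, measureReal_eq_zero_iff (hTc i).measure_lt_top.ne] at h
        filter_upwards [measure_eq_zero_iff_ae_notMem.1 h] with y hy _ using hy
      · exact ae_of_all _ fun y h => absurd h hi
    have hedge : ∀ᵐ y : Fin 2 → ℝ, ∀ i,
        y ∉ shadow b '' ((T i).closedInterior \ (T i).interior) :=
      ae_all_iff.2 fun i => measure_eq_zero_iff_ae_notMem.1 (volume_shadow_boundary b (T i))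
    have hconv : Convex ℝ (shadow b '' V) := hV.linear_image (shadow b).toLinearMap
    filter_upwards [hvert, hedge,
      measure_eq_zero_iff_ae_notMem.1 (hconv.addHaar_frontier volume)] with y hy₁ hy₂ hy₃
    by_cases hy : y ∈ shadow b '' V
    · obtain ⟨s, t, hst, hfib⟩ := exists_fiber_eq_Icc b hc hV hy
      -- Off the null frontier of the projection, the fiber passes through an interior point of `V`,
      -- so it is not a single point.
      obtain ⟨w, hw, hwy⟩ := interior_shadow_subset b hc hV hne
        (by_contra fun h => hy₃ ⟨subset_closure hy, h⟩)
      have hlt : s < t := by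
        have := mem_Ioo_of_lift_mem_interior b hfib (r := ⟪b 0, w⟫)
          (by rwa [← hwy, lift_inner_shadow])
        exact this.1.trans this.2
      have hind : (fun r => V.indicator (fun x => φ ⟪b 0, x⟫) (lift b r y)) =
          (Set.Icc s t).indicator φ := by
        ext r
        rw [← hfib]
        simp only [Set.indicator, Set.mem_ofPred_eq, inner_lift]
      rw [hind, integral_indicator measurableSet_Icc, integral_Icc_eq_integral_Ioc,
        ← intervalIntegral.integral_of_le hst,
        intervalIntegral.integral_eq_sub_of_hasDerivAt (fun x _ => hg x)
          (hφ.intervalIntegrable _ _)]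
      exact fiber_increment_le b hc hT hν hg0 hK hlt hfib hy₁ hy₂
    · have h1 : ∀ r, V.indicator (fun x => φ ⟪b 0, x⟫) (lift b r y) = 0 := fun r =>
        Set.indicator_of_notMem (fun h => hy ⟨_, h, shadow_lift b r y⟩) _
      have h2 : ∀ i, (shadow b '' (T i).closedInterior).indicator
          (fun _ => K i / |⟪b 0, ν i⟫|) y = 0 := fun i =>
        Set.indicator_of_notMem (fun h => hy (Set.image_mono (hTV i) h)) _
      simp [h1, h2]
  refine hle.trans ?_
  rw [integral_finsetSum _ fun i _ => hGint i]
  refine Finset.sum_le_sum fun i _ => ?_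
  rw [integral_indicator_const _ (hTc i).measurableSet, harea, smul_eq_mul]
  -- For a vertical triangle the projected area vanishes, and the bound `hK` reduces to 0 ≤ K i, so
  -- its term on the right is nonnegative.
  by_cases hi : ⟪b 0, ν i⟫ = 0
  · obtain ⟨x, hx⟩ := (T i).nonempty_closedInterior
    have := hK i x hx
    rw [hi, mul_zero] at this
    rw [hi, abs_zero, zero_mul, zero_mul]
    exact mul_nonneg this (harea0 i)
  · have : |⟪b 0, ν i⟫| ≠ 0 := abs_ne_zero.2 hi
    refine le_of_eq ?_
    field_simp

/-! ### The error function and the flux field -/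

lemma hasDerivAt_erf (x : ℝ) : HasDerivAt erf (2 / √Real.pi * Real.exp (-x ^ 2)) x := by
  have hcont : Continuous fun t : ℝ => Real.exp (-t ^ 2) := by fun_prop
  exact (intervalIntegral.integral_hasDerivAt_right (hcont.intervalIntegrable _ _)
    hcont.stronglyMeasurable.stronglyMeasurableAtFilter hcont.continuousAt).const_mul _

/-- The half-line Gaussian integral is √π/2 and `erf` is odd. This makes 1 + erf nonnegative, the
sign on which the fiber inequality rests. -/
lemma neg_one_le_erf (x : ℝ) : -1 ≤ erf x := by
  have hint : Integrable fun t : ℝ => Real.exp (-t ^ 2) := by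
    simpa using integrable_exp_neg_mul_sq one_pos
  have hhalf : ∫ t in Set.Ioi (0 : ℝ), Real.exp (-t ^ 2) = √Real.pi / 2 := by
    simpa using integral_gaussian_Ioi 1
  have hpi : 0 < √Real.pi := Real.sqrt_pos.2 Real.pi_pos
  have hneg : ∫ t in (0 : ℝ)..x, Real.exp (-t ^ 2) = -∫ t in (0 : ℝ)..(-x), Real.exp (-t ^ 2) := by
    have := intervalIntegral.integral_comp_neg (a := 0) (b := x) fun t : ℝ => Real.exp (-t ^ 2)
    simp only [even_two, Even.neg_pow, neg_zero] at this
    rw [this, intervalIntegral.integral_symm]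
  have hle : ∫ t in (0 : ℝ)..(-x), Real.exp (-t ^ 2) ≤ √Real.pi / 2 := by
    rw [← hhalf]
    rcases le_total 0 (-x) with h | h
    · rw [intervalIntegral.integral_of_le h]
      exact setIntegral_mono_set hint.integrableOn (ae_of_all _ fun t => (Real.exp_pos _).le)
        Set.Ioc_subset_Ioi_self.eventuallyLE
    · refine le_trans ?_ (integral_nonneg fun t => (Real.exp_pos _).le)
      rw [intervalIntegral.integral_symm]
      exact neg_nonpos.2 (intervalIntegral.integral_nonneg h fun t _ => (Real.exp_pos _).le)
  rw [erf, hneg]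
  have : 2 / √Real.pi * (√Real.pi / 2) = 1 := by field_simp
  nlinarith [mul_le_mul_of_nonneg_left hle (show 0 ≤ 2 / √Real.pi by positivity)]

/-- The scalar profile of the flux field. -/
noncomputable def fluxProfile (s : ℝ) : ℝ := (1 / (2 * Real.pi)) * (1 + erf (s / √2))

lemma fluxProfile_nonneg (s : ℝ) : 0 ≤ fluxProfile s :=
  mul_nonneg (by have := Real.pi_pos; positivity) (by linarith [neg_one_le_erf (s / √2)])

lemma hasDerivAt_fluxProfile (s : ℝ) :
    HasDerivAt fluxProfile ((1 / (2 * Real.pi)) *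
      (2 / √Real.pi * Real.exp (-(s / √2) ^ 2) * (1 / √2))) s :=
  (((hasDerivAt_erf (s / √2)).comp s ((hasDerivAt_id s).div_const √2)).const_add 1).const_mul _

lemma fluxProfile_monotone : Monotone fluxProfile :=
  monotone_of_hasDerivAt_nonneg hasDerivAt_fluxProfile fun s => by
    have := Real.pi_pos
    simp only [Pi.zero_apply]
    positivity

lemma inner_fluxField (n x v : E3) : ⟪fluxField n x, v⟫ = fluxProfile ⟪n, x⟫ * ⟪n, v⟫ := by
  rw [fluxField, real_inner_smul_left, real_inner_comm, fluxProfile]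

/-- The standard Gaussian density is bounded by the divergence of the flux field. -/
lemma gaussianDensity_le_deriv {n : E3} (hn : ‖n‖ = 1) (x : E3) :
    1 / √(8 * Real.pi ^ 3) * Real.exp (-(1 / 2) * ‖x‖ ^ 2) ≤
      (1 / (2 * Real.pi)) * (2 / √Real.pi * Real.exp (-(⟪n, x⟫ / √2) ^ 2) * (1 / √2)) := by
  have hpi := Real.pi_pos
  have hin : |⟪n, x⟫| ≤ ‖x‖ := by simpa [hn] using abs_real_inner_le_norm n x
  have hsq : ⟪n, x⟫ ^ 2 ≤ ‖x‖ ^ 2 := sq_le_sq' (abs_le.1 hin).1 (abs_le.1 hin).2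
  have hexp : Real.exp (-(1 / 2) * ‖x‖ ^ 2) ≤ Real.exp (-(⟪n, x⟫ / √2) ^ 2) := by
    rw [Real.exp_le_exp, div_pow, Real.sq_sqrt zero_le_two]
    linarith
  -- Since √(8π³) = 2√(2π³), this constant is twice that of the Gaussian density, so the comparison
  -- of constants below has a factor 2 to spare.
  have hconst : (1 / (2 * Real.pi)) * (2 / √Real.pi) * (1 / √2) = 1 / √(2 * Real.pi ^ 3) := by
    have : √(2 * Real.pi ^ 3) = Real.pi * √Real.pi * √2 := by
      rw [show 2 * Real.pi ^ 3 = Real.pi ^ 2 * (Real.pi * 2) by ring,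
        Real.sqrt_mul (by positivity), Real.sqrt_sq hpi.le, Real.sqrt_mul hpi.le, mul_assoc]
    rw [this]
    field_simp
  calc 1 / √(8 * Real.pi ^ 3) * Real.exp (-(1 / 2) * ‖x‖ ^ 2)
      ≤ 1 / √(2 * Real.pi ^ 3) * Real.exp (-(⟪n, x⟫ / √2) ^ 2) := by
        refine mul_le_mul ?_ hexp (Real.exp_pos _).le (by positivity)
        exact one_div_le_one_div_of_le (by positivity)
          (Real.sqrt_le_sqrt (by nlinarith [pow_pos hpi 3]))
    _ = _ := by rw [← hconst]; ring

/-- The profile is increasing and ⟪n, ·⟫ is linear, so its extremes over the triangle occur at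
vertices: the maximum serves when ⟪n, v⟫ ≥ 0, the minimum when ⟪n, v⟫ ≤ 0. -/
lemma fluxProfile_mul_le_sup' (t : Affine.Triangle ℝ E3) (n v : E3) {x : E3}
    (hx : x ∈ t.closedInterior) :
    fluxProfile ⟪n, x⟫ * ⟪n, v⟫ ≤ Finset.univ.sup' Finset.univ_nonempty
      fun j : Fin 3 => ⟪fluxField n (t.points j), v⟫ := by
  rw [← Affine.Simplex.convexHull_eq_closedInterior] at hx
  suffices ∃ j, fluxProfile ⟪n, x⟫ * ⟪n, v⟫ ≤ ⟪fluxField n (t.points j), v⟫ by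
    obtain ⟨j, hj⟩ := this
    exact hj.trans (Finset.le_sup' (fun j : Fin 3 => ⟪fluxField n (t.points j), v⟫)
      (Finset.mem_univ j))
  rcases le_total 0 ⟪n, v⟫ with h | h
  · obtain ⟨_, ⟨j, rfl⟩, hj⟩ := ((innerSL ℝ n).toLinearMap.convexOn
      (convex_convexHull ℝ (Set.range t.points))).exists_ge_of_mem_convexHull
      (subset_convexHull ℝ _) hx
    refine ⟨j, ?_⟩
    rw [inner_fluxField]
    exact mul_le_mul_of_nonneg_right (fluxProfile_monotone hj) h
  · obtain ⟨_, ⟨j, rfl⟩, hj⟩ := ((innerSL ℝ n).toLinearMap.concaveOn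
      (convex_convexHull ℝ (Set.range t.points))).exists_le_of_mem_convexHull
      (subset_convexHull ℝ _) hx
    refine ⟨j, ?_⟩
    rw [inner_fluxField]
    exact mul_le_mul_of_nonpos_right (fluxProfile_monotone hj) h

/-- The surface bound for the standard Gaussian measure of a convex body. -/
lemma integral_gaussianDensity_le_surfaceBound {V : Set E3} (hc : IsCompact V) (hV : Convex ℝ V)
    (hne : (interior V).Nonempty)
    {ι : Type*} [Fintype ι] {T : ι → Affine.Triangle ℝ E3} {ν : ι → E3}
    (hT : IsBoundaryTriangulation V T) (hν : ∀ i, IsOutwardUnitNormal V (T i) (ν i))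
    {n : E3} (hn : ‖n‖ = 1) :
    ∫ x in V, 1 / √(8 * Real.pi ^ 3) * Real.exp (-(1 / 2) * ‖x‖ ^ 2) ≤ surfaceBound T ν n := by
  -- Completing `n` to an orthonormal basis with b₀ = n makes the fibers run along the direction of
  -- the flux field.
  obtain ⟨b, hb⟩ := Orthonormal.exists_orthonormalBasis_extension_of_card_eq (𝕜 := ℝ) (E := E3)
    (ι := Fin 3) (by simp) (v := fun _ => n) (s := {0})
    (by
      rw [orthonormal_iff_ite]
      rintro ⟨i, rfl⟩ ⟨j, rfl⟩
      simp [Set.domRestrict, hn])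
  replace hb : b 0 = n := hb 0 rfl
  subst hb
  refine le_trans (setIntegral_mono_on ?_ ?_ hc.measurableSet fun x _ =>
    gaussianDensity_le_deriv hn x) (integral_deriv_le_sum_area b hc hV hne hT hν
      fluxProfile_nonneg hasDerivAt_fluxProfile (by fun_prop)
      fun i x hx => fluxProfile_mul_le_sup' (T i) (b 0) (ν i) hx)
  · exact ContinuousOn.integrableOn_compact hc (by fun_prop)
  · exact ContinuousOn.integrableOn_compact hc (by fun_prop)

end PCD

/-! ### Assembly of the main theorem -/

theorem theorem1
    (S : Matrix (Fin 3) (Fin 3) ℝ) (hS : S.PosDef)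
    (A B : Set PCD.E3) (hA : PCD.IsConvexPolytope A) (hB : PCD.IsConvexPolytope B)
    (hAB : (interior (-A + B)).Nonempty)
    {Ω : Type*} [MeasurableSpace Ω] (μ : Measure Ω) [IsProbabilityMeasure μ]
    (ε : ℕ → Ω → PCD.E3) (hlaw : ∀ i, HasLaw (ε i) (multivariateGaussian (0 : PCD.E3) S) μ)
    (hind : iIndepFun ε μ)
    (nd : PCD.E3)
    (hnd : PCD.IsMinDisplacementDirection (PCD.whiten S '' A) (PCD.whiten S '' B) nd)
    {ι : Type*} [Fintype ι] (T : ι → Affine.Triangle ℝ PCD.E3) (ν : ι → PCD.E3)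
    (hT : PCD.IsBoundaryTriangulation (PCD.whitenedSum S A B) T)
    (hν : ∀ i, PCD.IsOutwardUnitNormal (PCD.whitenedSum S A B) (T i) (ν i)) :
    -- the exact collision probability
    (PCD.collisionProb S A B = (multivariateGaussian (0 : PCD.E3) S).real (-A + B) ∧
      PCD.collisionProb S A B =
        ∫ x in PCD.whitenedSum S A B, 1 / √(8 * Real.pi ^ 3) * Real.exp (-(1 / 2) * ‖x‖ ^ 2)) ∧
    -- mean and variance of the Monte Carlo estimate
    (∀ n : ℕ, 1 ≤ n →
      MemLp (PCD.mcEstimate A B ε n) 2 μ ∧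
      ∫ ω, PCD.mcEstimate A B ε n ω ∂μ = PCD.collisionProb S A B ∧
      variance (PCD.mcEstimate A B ε n) μ =
        PCD.collisionProb S A B * (1 - PCD.collisionProb S A B) / n) ∧
    Tendsto (fun n => variance (PCD.mcEstimate A B ε n) μ) atTop (𝓝 0) ∧
    -- almost sure convergence to the exact probability
    (∀ᵐ ω ∂μ, Tendsto (fun n => PCD.mcEstimate A B ε n ω) atTop (𝓝 (PCD.collisionProb S A B))) ∧
    -- the upper bound, for the exact probability and for the limit of the estimates
    PCD.collisionProb S A B ≤ PCD.surfaceBound T ν nd ∧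
    (∀ᵐ ω ∂μ, limsup (fun n => PCD.mcEstimate A B ε n ω) atTop ≤ PCD.surfaceBound T ν nd) := by
  have hVc : IsCompact (-A + B) := hA.isCompact.neg.add hB.isCompact
  have hVconv : Convex ℝ (-A + B) := hA.convex.neg.add hB.convex
  have hWc : IsCompact (PCD.whitenedSum S A B) := hVc.image (PCD.whiten S).continuous
  have hWconv : Convex ℝ (PCD.whitenedSum S A B) :=
    hVconv.linear_image (PCD.whiten S).toLinearMap
  have hprob := PCD.collisionProb_eq_real S A B
  have hint : PCD.collisionProb S A B = ∫ x in PCD.whitenedSum S A B,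
      1 / √(8 * Real.pi ^ 3) * Real.exp (-(1 / 2) * ‖x‖ ^ 2) := by
    rw [hprob, PCD.multivariateGaussian_real_apply hS hVc.measurableSet]
    exact PCD.stdGaussian_real_apply hWc.measurableSet
  have hbound : PCD.collisionProb S A B ≤ PCD.surfaceBound T ν nd :=
    hint ▸ PCD.integral_gaussianDensity_le_surfaceBound hWc hWconv
      (PCD.interior_whitenedSum_nonempty hS hAB) hT hν hnd.1
  obtain ⟨hmom, hlim⟩ := PCD.mcEstimate_moments hVc.measurableSet hlaw hind
  rw [← hprob] at hmom hlim
  refine ⟨⟨hprob, hint⟩, hmom, ?_, hlim, hbound, ?_⟩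
  · refine (tendsto_const_div_atTop_nhds_zero_nat
      (PCD.collisionProb S A B * (1 - PCD.collisionProb S A B))).congr' ?_
    -- The variance formula is available only for n ≥ 1, which is enough for the limit.
    filter_upwards [eventually_ge_atTop 1] with n hn
    exact ((hmom n hn).2.2).symm
  · filter_upwards [hlim] with ω hω
    rw [hω.limsup_eq]
    exact hbound
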